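/- Let $R$ be a commutative Noetherian ring of finite Krull dimension and let $M$ be a finitely generated $R$-module. The (ordinal) length $\ell(M)$ of a module $M$ is the supremum of all ordinals $\alpha$ for which there is a strictly descending chain of non-zero submodules of $M$ of order type $\alpha$ (for a module of finite length this is the usual length). The finitistic length $\ell^{\mathrm{fin}}(M)$ is the supremum of all $\ell(N)$, where $N$ runs over the submodules of $M$ with $\ell(N)<\omega$. The fundamental cycle of $M$ is the element $\sum_{\mathfrak p}\ell^{\mathrm{fin}}(M_{\mathfrak p})\,[\mathfrak p]$ of the free abelian group on the prime ideals of $R$, where $\mathfrak p$ runs over the associated primes of $M$ and the localization $M_{\mathfrak p}$ is viewed as an $R_{\mathfrak p}$-module. Call $M$ binary if its fundamental cycle is a sum of distinct primes, that is, of the form $\sum_{\mathfrak p\in S}[\mathfrak p]$ for some finite set $S$ of prime ideals of $R$. Call a submodule $N\subseteq M$ open if $\ell(N)=\ell(M)$, and essential if $N\cap H\neq 0$ for every non-zero submodule $H\subseteq M$. Assume that $M$ is binary, and let $N$ be a submodule of $M$. Then $N$ is open if and only if it is essential. -/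

import Mathlib

noncomputable section

universe u v

/-- The ordinal `α` arises as a descending chain of nonzero submodules of `M`: there is a strictly
decreasing family of nonzero submodules indexed by the ordinals below `α`. -/
def IsChainOrdinal (R : Type u) (M : Type v) [CommRing R] [AddCommGroup M] [Module R M]
    (α : Ordinal.{v}) : Prop :=
  ∃ f : Ordinal.{v} → Submodule R M,
    StrictAntiOn f (Set.Iio α) ∧ ∀ β < α, f β ≠ ⊥

/-- The ordinals that arise as chains are bounded, so that their supremum is meaningful. -/
theorem bddAbove_isChainOrdinal (R : Type u) (M : Type v) [CommRing R] [AddCommGroup M]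
    [Module R M] : BddAbove {α : Ordinal.{v} | IsChainOrdinal R M α} := by
  refine ⟨(Order.succ (Cardinal.mk (Submodule R M))).ord, ?_⟩
  rintro α ⟨f, hf, -⟩
  by_contra! h
  have hinj : Function.Injective (fun x : Set.Iio α => f x.1) := fun x y hxy =>
    Subtype.ext (hf.injOn x.2 y.2 hxy)
  have h1 := Cardinal.mk_le_of_injective
    (f := fun x : ULift.{v + 1} (Set.Iio α) => ULift.up.{v + 1} (f x.down.1))
    (fun x y hxy => by
      have := hinj (a₁ := x.down) (a₂ := y.down) (by simpa using hxy)
      exact ULift.ext _ _ this)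
  have h2 : Cardinal.lift.{v + 1} α.card ≤ Cardinal.lift.{v + 1} (Cardinal.mk (Submodule R M)) := by
    simpa using h1
  have h3 := Cardinal.lift_le.1 h2
  have h4 : (Order.succ (Cardinal.mk (Submodule R M))) ≤ α.card := Cardinal.ord_le.1 h.le
  exact absurd (h4.trans h3) (not_le.2 (Order.lt_succ _))

/-- The ordinal length of a module: the supremum of all ordinals that arise as descending chains
of submodules. The zero submodule is not counted, so that a module of finite length has its usual
length. -/
def ordinalLength (R : Type u) (M : Type v) [CommRing R] [AddCommGroup M] [Module R M] :
    Ordinal.{v} :=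
  sSup {α : Ordinal.{v} | IsChainOrdinal R M α}

/-- The finitistic length of a (Noetherian) module: the supremum of the ordinal lengths of its
submodules of length less than `ω`. -/
def finitisticLength (R : Type u) (M : Type v) [CommRing R] [AddCommGroup M] [Module R M] : ℕ :=
  sSup {n : ℕ | ∃ N : Submodule R M, ordinalLength R N = (n : Ordinal.{v})}

/-- Cycles on `R`: the free abelian group on the prime ideals of `R`. -/
abbrev ChowCycle (R : Type u) [CommRing R] : Type u := PrimeSpectrum R →₀ ℤ

/-- The associated primes of a finitely generated module over a Noetherian ring. -/
def assFinset (R : Type u) (M : Type v) [CommRing R] [IsNoetherianRing R] [AddCommGroup M]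
    [Module R M] [Module.Finite R M] : Finset (PrimeSpectrum R) :=
  ((associatedPrimes.finite R M).preimage
    (f := PrimeSpectrum.asIdeal) (fun _ _ _ _ h => PrimeSpectrum.ext h)).toFinset

/-- The fundamental cycle of `M`: the sum over the associated primes `p` of `M` of
`ℓ(M_p) [p]`, where `ℓ(M_p)` is the finitistic length of the localization `M_p` as a module over
the local ring `R_p`. -/
def fundamentalCycle (R : Type u) (M : Type v) [CommRing R] [IsNoetherianRing R]
    [AddCommGroup M] [Module R M] [Module.Finite R M] : ChowCycle R :=
  ∑ p ∈ assFinset R M,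
    Finsupp.single p (finitisticLength (Localization.AtPrime p.asIdeal)
      (LocalizedModule p.asIdeal.primeCompl M) : ℤ)

/-- A module is binary if its fundamental cycle is a sum of distinct primes. -/
def IsBinary (R : Type u) (M : Type v) [CommRing R] [IsNoetherianRing R]
    [AddCommGroup M] [Module R M] [Module.Finite R M] : Prop :=
  ∃ S : Finset (PrimeSpectrum R),
    fundamentalCycle R M = ∑ p ∈ S, Finsupp.single p (1 : ℤ)

/-- A submodule is open if it has the same ordinal length as the whole module. -/
def IsOpenSubmodule {R : Type u} {M : Type v} [CommRing R] [AddCommGroup M] [Module R M]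
    (N : Submodule R M) : Prop :=
  ordinalLength R N = ordinalLength R M

/-- A submodule is essential if it meets every nonzero submodule non-trivially. -/
def IsEssentialSubmodule {R : Type u} {M : Type v} [CommRing R] [AddCommGroup M] [Module R M]
    (N : Submodule R M) : Prop :=
  ∀ H : Submodule R M, H ≠ ⊥ → N ⊓ H ≠ ⊥

end

-- Write dim p for the dimension of `R ⧸ p` (`primeDim`), and order sums of powers of ω by
-- decreasing exponent. Two bounds hold for every finitely generated M. From below, ℓ(M) is at least
-- the sum of ω^(dim p) over the associated primes p (`omegaSum_card_le_ordinalLength`), because M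
-- contains a direct sum of copies of the `R ⧸ p`. From above, ℓ(M) is at most the same sum weighted
-- by the local multiplicities `primeMult` (`ordinalLength_le_omegaSum_dimMult`), because the
-- weighted sum drops strictly on passing to a proper quotient
-- (`omegaSum_dimMult_lt_of_surjective`).
--
-- For binary M every multiplicity at an associated prime is 1, so the bounds agree. If N ∩ H = 0
-- with H ≠ 0, then N embeds in M/H, whose upper bound lies strictly below ℓ(M); so N is not open.
-- If N is essential, it has the same associated primes as M, so its lower bound already equals
-- ℓ(M).

universe w

/-! ### Chains of ordinal type in a preorder -/

/-- There is a strictly descending chain of order type `α` in the half-open interval `(a, b]`. -/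
def HasChain {L : Type*} [Preorder L] (a b : L) (α : Ordinal.{w}) : Prop :=
  ∃ f : Ordinal.{w} → L, StrictAntiOn f (Set.Iio α) ∧ ∀ β < α, a < f β ∧ f β ≤ b

namespace HasChain

variable {L L' : Type*} [Preorder L] [Preorder L'] {a b c : L} {α β : Ordinal.{w}}

theorem zero (a b : L) : HasChain a b (0 : Ordinal.{w}) :=
  ⟨fun _ => a, fun _ h => absurd h (by simp), fun _ h => absurd h (by simp)⟩

theorem one (h : a < b) : HasChain a b (1 : Ordinal.{w}) := by
  refine ⟨fun _ => b, fun x hx y hy hxy => ?_, fun _ _ => ⟨h, le_rfl⟩⟩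
  simp only [Set.mem_Iio, Order.lt_one_iff] at hx hy
  exact absurd hxy (by simp [hx, hy])

theorem mono_ordinal (h : HasChain a b β) (hαβ : α ≤ β) : HasChain a b α := by
  obtain ⟨f, hf, hf'⟩ := h
  exact ⟨f, hf.mono (Set.Iio_subset_Iio hαβ), fun γ hγ => hf' γ (hγ.trans_le hαβ)⟩

theorem map (h : HasChain a b α) (φ : L → L') {a' b' : L'}
    (hφ : ∀ x y, a < x → x < y → y ≤ b → φ x < φ y)
    (ha : ∀ x, a < x → x ≤ b → a' < φ x) (hb : ∀ x, a < x → x ≤ b → φ x ≤ b') :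
    HasChain a' b' α := by
  obtain ⟨f, hf, hf'⟩ := h
  exact ⟨φ ∘ f, fun x hx y hy hxy => hφ _ _ (hf' y hy).1 (hf hx hy hxy) (hf' x hx).2,
    fun γ hγ => ⟨ha _ (hf' γ hγ).1 (hf' γ hγ).2, hb _ (hf' γ hγ).1 (hf' γ hγ).2⟩⟩

theorem mono (h : HasChain a b α) {a' b' : L} (ha : a' ≤ a) (hb : b ≤ b') :
    HasChain a' b' α :=
  h.map id (fun _ _ _ h _ => h) (fun _ h _ => ha.trans_lt h) (fun _ _ h => h.trans hb)

/-- Descending chains start at the top, so the upper interval contributes the left summand; ordinal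
addition does not commute. -/
theorem add (h₁ : HasChain b c α) (h₂ : HasChain a b β) (hab : a ≤ b) (hbc : b ≤ c) :
    HasChain a c (α + β) := by
  obtain ⟨f, hf, hf'⟩ := h₁
  obtain ⟨g, hg, hg'⟩ := h₂
  have key : ∀ {γ}, ¬ γ < α → γ < α + β → γ - α < β := fun h h' =>
    Ordinal.sub_lt_of_lt_add h' (by
      rcases eq_or_ne β 0 with rfl | h0
      · simp at h'; exact absurd h' h
      · exact pos_iff_ne_zero.2 h0)
  refine ⟨fun γ => if γ < α then f γ else g (γ - α), fun x hx y hy hxy => ?_, fun γ hγ => ?_⟩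
  · by_cases hyα : y < α
    · simpa [hyα, hxy.trans hyα] using hf (hxy.trans hyα) hyα hxy
    · by_cases hxα : x < α
      · simpa [hyα, hxα] using (hg' _ (key hyα hy)).2.trans_lt (hf' _ hxα).1
      · simp only [hyα, hxα, if_false]
        refine hg (key hxα hx) (key hyα hy) ?_
        rwa [← add_lt_add_iff_left α, Ordinal.add_sub_cancel_of_le (not_lt.1 hxα),
          Ordinal.add_sub_cancel_of_le (not_lt.1 hyα)]
  · by_cases h : γ < α
    · simpa [h] using ⟨hab.trans_lt (hf' _ h).1, (hf' _ h).2⟩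
    · simpa [h] using ⟨(hg' _ (key h hγ)).1, (hg' _ (key h hγ)).2.trans hbc⟩

/-- Chains between consecutive terms of a descending sequence can be concatenated. -/
theorem mul_omega0 (u : ℕ → L) (hu : ∀ n, u (n + 1) ≤ u n) (ha : ∀ n, a ≤ u n)
    (h : ∀ n, HasChain (u (n + 1)) (u n) α) : HasChain a (u 0) (α * Ordinal.omega0) := by
  have hu' : Antitone u := antitone_nat_of_succ_le hu
  choose f hf hf' using h
  rcases eq_or_ne α 0 with rfl | hα
  · rw [zero_mul]; exact zero _ _
  have hdiv : ∀ γ, γ < α * Ordinal.omega0 → ∃ n : ℕ, γ / α = n := fun γ hγ =>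
    Ordinal.lt_omega0.1 ((Ordinal.lt_mul_iff_div_lt hα).1 hγ)
  choose! q hq using hdiv
  have hmod : ∀ γ, γ % α < α := fun γ => Ordinal.mod_lt γ hα
  -- Division with remainder by `α`: the quotient selects the block, the remainder the position in
  -- it.
  refine ⟨fun γ => f (q γ) (γ % α), fun x hx y hy hxy => ?_, fun γ hγ => ?_⟩
  · have hle : q x ≤ q y := by
      have : x / α ≤ y / α := Ordinal.div_le_left hxy.le α
      rw [hq _ hx, hq _ hy] at this
      exact_mod_cast this
    rcases hle.eq_or_lt with heq | hlt
    · simp only [heq]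
      refine hf _ (hmod x) (hmod y) ?_
      have hx' := Ordinal.div_add_mod x α
      have hy' := Ordinal.div_add_mod y α
      rw [← hx', ← hy', hq _ hx, hq _ hy, heq] at hxy
      exact lt_of_add_lt_add_left hxy
    · exact ((hf' _ _ (hmod y)).2.trans (hu' (Nat.succ_le_of_lt hlt))).trans_lt
        (hf' _ _ (hmod x)).1
  · exact ⟨(ha _).trans_lt (hf' _ _ (hmod γ)).1, (hf' _ _ (hmod γ)).2.trans (hu' (Nat.zero_le _))⟩

end HasChain

/-! ### Sums of powers of ω -/

/-- The ordinal `∑ ω ^ j * n j`, over `j < i` in decreasing order. -/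
noncomputable def omegaSum (n : ℕ → ℕ) : ℕ → Ordinal.{w}
  | 0 => 0
  | i + 1 => Ordinal.omega0 ^ i * (n i : Ordinal) + omegaSum n i

theorem omegaSum_lt (n : ℕ → ℕ) (i : ℕ) : omegaSum n i < Ordinal.omega0.{w} ^ i := by
  induction i with
  | zero => simp [omegaSum]
  | succ i ih =>
    calc omegaSum n (i + 1) < Ordinal.omega0 ^ i * (n i : Ordinal) + Ordinal.omega0 ^ i := by
          simpa [omegaSum] using ih
      _ = Ordinal.omega0 ^ i * ((n i + 1 : ℕ) : Ordinal) := by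
          rw [Nat.cast_succ, mul_add_one]
      _ ≤ Ordinal.omega0 ^ i * Ordinal.omega0 := by gcongr; exact (Ordinal.natCast_lt_omega0 _).le
      _ = _ := (pow_succ _ _).symm

theorem omegaSum_congr {n n' : ℕ → ℕ} {i : ℕ} (h : ∀ j < i, n j = n' j) :
    omegaSum.{w} n i = omegaSum n' i := by
  induction i with
  | zero => rfl
  | succ i ih => rw [omegaSum, omegaSum, h i (by simp), ih fun j hj => h j (by lia)]

/-- The comparison is lexicographic from the top exponent: by `omegaSum_lt`, all terms below
exponent `d` together stay under one extra `ω ^ d`. -/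
theorem omegaSum_lt_omegaSum {n n' : ℕ → ℕ} {d i : ℕ} (hd : d < i) (hlt : n d < n' d)
    (heq : ∀ j, d < j → n j = n' j) : omegaSum.{w} n i < omegaSum n' i := by
  induction i with
  | zero => lia
  | succ i ih =>
    rcases (Nat.lt_succ_iff.1 hd).eq_or_lt with rfl | hlt'
    · calc omegaSum n (d + 1) < Ordinal.omega0 ^ d * (n d : Ordinal) + Ordinal.omega0 ^ d := by
            simpa [omegaSum] using omegaSum_lt n d
        _ = Ordinal.omega0 ^ d * ((n d + 1 : ℕ) : Ordinal) := by
            rw [Nat.cast_succ, mul_add_one]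
        _ ≤ Ordinal.omega0 ^ d * (n' d : Ordinal) := by gcongr; exact_mod_cast hlt
        _ ≤ _ := by rw [omegaSum]; exact le_self_add
    · rw [omegaSum, omegaSum, heq i hlt']
      gcongr
      exact ih hlt'

/-! ### Ordinal length and its agreement with `Module.length` -/

section OrdinalLength

variable {R : Type u} {M : Type v} [CommRing R] [AddCommGroup M] [Module R M]

theorem isChainOrdinal_iff_hasChain {α : Ordinal.{v}} :
    IsChainOrdinal R M α ↔ HasChain (⊥ : Submodule R M) ⊤ α := by
  simp [IsChainOrdinal, HasChain, bot_lt_iff_ne_bot]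

theorem IsChainOrdinal.le_ordinalLength {α : Ordinal.{v}} (h : IsChainOrdinal R M α) :
    α ≤ ordinalLength R M :=
  le_csSup (bddAbove_isChainOrdinal R M) h

theorem ordinalLength_le {α : Ordinal.{v}} (h : ∀ β, IsChainOrdinal R M β → β ≤ α) :
    ordinalLength R M ≤ α :=
  csSup_le' h

theorem IsChainOrdinal.map {N : Type v} [AddCommGroup N] [Module R N] (φ : N →ₗ[R] M)
    (hφ : Function.Injective φ) {α : Ordinal.{v}} (h : IsChainOrdinal R N α) :
    IsChainOrdinal R M α := by
  rw [isChainOrdinal_iff_hasChain] at h ⊢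
  refine h.map (Submodule.map φ) (fun x y _ hxy _ => Submodule.map_strictMono_of_injective hφ hxy)
    (fun x hx _ => ?_) (fun _ _ _ => le_top)
  simpa using Submodule.map_strictMono_of_injective hφ hx

theorem ordinalLength_le_of_injective {N : Type v} [AddCommGroup N] [Module R N] (φ : N →ₗ[R] M)
    (hφ : Function.Injective φ) : ordinalLength R N ≤ ordinalLength R M :=
  ordinalLength_le fun _ h => (h.map φ hφ).le_ordinalLength

theorem isChainOrdinal_natCast_iff {n : ℕ} :
    IsChainOrdinal R M (n : Ordinal.{v}) ↔ (n : ℕ∞) ≤ Module.length R M := by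
  constructor
  · rintro ⟨f, hf, hf'⟩
    rw [Module.length_eq_coheight]
    cases n with
    | zero => simp
    | succ n =>
      have hk : ∀ k ≤ n, (k : ℕ∞) ≤ Order.coheight (f k) := by
        intro k
        induction k with
        | zero => simp
        | succ k ih =>
          intro hk
          have h1 : f ((k + 1 : ℕ) : Ordinal) < f (k : Ordinal) :=
            hf (by simp only [Set.mem_Iio, Nat.cast_lt]; lia)
              (by simp only [Set.mem_Iio, Nat.cast_lt]; lia) (by simp)
          calc ((k + 1 : ℕ) : ℕ∞) ≤ Order.coheight (f k) + 1 := by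
                push_cast; gcongr; exact ih (by lia)
            _ ≤ _ := Order.coheight_add_one_le h1
      calc ((n + 1 : ℕ) : ℕ∞) ≤ Order.coheight (f n) + 1 := by
            push_cast; gcongr; exact hk n le_rfl
        _ ≤ _ := Order.coheight_add_one_le
            (bot_lt_iff_ne_bot.2 (hf' n (by exact_mod_cast Nat.lt_succ_self n)))
  · intro h
    rw [Module.length_eq_height] at h
    obtain ⟨p, hp, hl⟩ := Order.exists_series_of_le_height _ h
    have hc : ∀ β < (n : Ordinal.{v}), ∃ k : Fin (p.length + 1), 0 < k ∧ β + (k : ℕ) = n := by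
      intro β hβ
      obtain ⟨m, rfl⟩ := Ordinal.lt_omega0.1 (hβ.trans (Ordinal.natCast_lt_omega0 n))
      have hm : m < n := by exact_mod_cast hβ
      -- The series ascends, so position `m` of the chain takes entry `n - m`; entry `0`, possibly
      -- the zero submodule, is never reached.
      refine ⟨⟨n - m, by lia⟩, by simpa [Fin.lt_def] using hm, ?_⟩
      norm_cast
      simp only
      lia
    choose! k hk0 hk using hc
    refine ⟨fun β => p (k β), fun x hx y hy hxy => p.strictMono ?_, fun β hβ => ?_⟩
    · by_contra hle
      have h2 : ((k x : ℕ) : Ordinal.{v}) ≤ ((k y : ℕ) : Ordinal.{v}) := by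
        exact_mod_cast not_lt.1 hle
      obtain ⟨m, rfl⟩ := Ordinal.lt_omega0.1 (hy.trans (Ordinal.natCast_lt_omega0 n))
      obtain ⟨l, rfl⟩ := Ordinal.lt_omega0.1 (hx.trans (Ordinal.natCast_lt_omega0 n))
      have e1 := hk _ hx
      have e2 := hk _ hy
      norm_cast at e1 e2 h2 hxy
      lia
    · exact ((bot_le (a := p 0)).trans_lt (p.strictMono (hk0 β hβ))).ne'

theorem ordinalLength_eq_natCast_iff {n : ℕ} :
    ordinalLength R M = (n : Ordinal.{v}) ↔ Module.length R M = n := by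
  have hiff : ∀ m : ℕ, (m : Ordinal.{v}) ≤ ordinalLength R M ↔ (m : ℕ∞) ≤ Module.length R M := by
    intro m
    rw [← isChainOrdinal_natCast_iff]
    refine ⟨fun h => ?_, IsChainOrdinal.le_ordinalLength⟩
    cases m with
    | zero => simpa [isChainOrdinal_iff_hasChain] using HasChain.zero _ _
    | succ m =>
      have hlt : (m : Ordinal.{v}) < ordinalLength R M :=
        lt_of_lt_of_le (by exact_mod_cast Nat.lt_succ_self m) h
      obtain ⟨α, hα, hm⟩ := exists_lt_of_lt_csSup' hlt
      rw [isChainOrdinal_iff_hasChain]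
      refine (isChainOrdinal_iff_hasChain.1 hα).mono_ordinal ?_
      push_cast
      exact Order.add_one_le_of_lt hm
  constructor
  · intro h
    refine le_antisymm ?_ ((hiff n).1 h.ge)
    by_contra! hlt
    have : ((n + 1 : ℕ) : Ordinal.{v}) ≤ ordinalLength R M :=
      (hiff (n + 1)).2 (by push_cast; exact Order.add_one_le_of_lt hlt)
    rw [h] at this
    exact absurd this (by exact_mod_cast Nat.not_succ_le_self n)
  · intro h
    refine le_antisymm ?_ ((hiff n).2 h.ge)
    by_contra! hlt
    have : ((n + 1 : ℕ) : ℕ∞) ≤ Module.length R M :=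
      (hiff (n + 1)).1 (by push_cast; exact Order.add_one_le_of_lt hlt)
    rw [h] at this
    exact absurd this (by exact_mod_cast Nat.not_succ_le_self n)

end OrdinalLength

/-! ### Finitistic length of Noetherian modules -/

section FinitisticLength

variable {R : Type u} {M : Type v} [CommRing R] [AddCommGroup M] [Module R M]

/-- A Noetherian module has a largest submodule of finite length. -/
theorem exists_greatest_isFiniteLength [IsNoetherian R M] :
    ∃ K : Submodule R M, IsFiniteLength R K ∧ ∀ N : Submodule R M, IsFiniteLength R N → N ≤ K := by
  obtain ⟨K, hK, hmax⟩ := set_has_maximal_iff_noetherian.2 ‹IsNoetherian R M›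
    {N : Submodule R M | IsFiniteLength R N} ⟨⊥, .of_subsingleton⟩
  refine ⟨K, hK, fun N hN => ?_⟩
  have hsup : IsFiniteLength R (K ⊔ N : Submodule R M) := by
    have h1 := (isFiniteLength_iff_isNoetherian_isArtinian.1 hK).2
    have h2 := (isFiniteLength_iff_isNoetherian_isArtinian.1 hN).2
    exact isFiniteLength_iff_isNoetherian_isArtinian.2 ⟨inferInstance, inferInstance⟩
  by_contra hle
  exact hmax _ hsup (lt_of_le_of_ne le_sup_left fun h => hle (h ▸ le_sup_right))

/-- The length of `K` bounds the set in the definition, so its `sSup` in `ℕ` is a genuine maximum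
and not the default value. -/
theorem finitisticLength_eq {K : Submodule R M} (hK : IsFiniteLength R K)
    (hmax : ∀ N : Submodule R M, IsFiniteLength R N → N ≤ K) :
    (finitisticLength R M : ℕ∞) = Module.length R K := by
  obtain ⟨k, hk⟩ := ENat.ne_top_iff_exists.1 (Module.length_ne_top_iff.2 hK)
  rw [← hk, Nat.cast_inj]
  simp only [finitisticLength, ordinalLength_eq_natCast_iff]
  have hg : IsGreatest {n : ℕ | ∃ N : Submodule R M, Module.length R N = n} k := by
    refine ⟨⟨K, hk.symm⟩, ?_⟩
    rintro n ⟨N, hN⟩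
    have hle := hmax N (Module.length_ne_top_iff.1 (by simp [hN]))
    have := Module.length_le_of_injective _ (Submodule.inclusion_injective hle)
    rw [hN, ← hk] at this
    exact_mod_cast this
  exact hg.csSup_eq

/-- The largest finite-length submodule of `M` contains the image of `N`. Its image in `P` is again
the largest, since preimages of finite-length submodules have finite length. -/
theorem finitisticLength_eq_add_of_exact [IsNoetherian R M] {N P : Type*} [AddCommGroup N]
    [AddCommGroup P] [Module R N] [Module R P] {f : N →ₗ[R] M} {g : M →ₗ[R] P}
    (hf : Function.Injective f) (hg : Function.Surjective g) (hfg : Function.Exact f g)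
    (hN : IsFiniteLength R N) :
    (finitisticLength R M : ℕ∞) = Module.length R N + finitisticLength R P := by
  obtain ⟨K, hK, hmax⟩ := exists_greatest_isFiniteLength (R := R) (M := M)
  have hfK : ∀ x, f x ∈ K := fun x => hmax (LinearMap.range f)
    (hN.of_surjective (f := f.rangeRestrict) f.surjective_rangeRestrict) ⟨x, rfl⟩
  let f' : N →ₗ[R] K := f.codRestrict K hfK
  let g' : K →ₗ[R] K.map g := g.submoduleMap K
  have hf' : Function.Injective f' := fun x y h => hf (congrArg Subtype.val h)
  have hg' : Function.Surjective g' := g.submoduleMap_surjective K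
  have hex : Function.Exact f' g' := by
    intro x
    have : g' x = 0 ↔ g x = 0 := by
      rw [← Submodule.coe_eq_zero]; rfl
    rw [this, hfg]
    exact ⟨fun ⟨y, hy⟩ => ⟨y, Subtype.ext hy⟩, fun ⟨y, hy⟩ => ⟨y, congrArg Subtype.val hy⟩⟩
  rw [finitisticLength_eq hK hmax, Module.length_eq_add_of_exact f' g' hf' hg' hex,
    finitisticLength_eq (hK.of_surjective hg')]
  intro L hL
  have hc : IsFiniteLength R (L.comap g) := by
    let a : N →ₗ[R] L.comap g := f.codRestrict _ fun x => by
      simp [hfg.apply_apply_eq_zero x]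
    let b : L.comap g →ₗ[R] L := g.restrict fun x hx => hx
    have ha : Function.Injective a := fun x y h => hf (congrArg Subtype.val h)
    have hb : Function.Surjective b := by
      rintro ⟨y, hy⟩
      obtain ⟨x, rfl⟩ := hg y
      exact ⟨⟨x, hy⟩, rfl⟩
    have hab : Function.Exact a b := by
      intro x
      have : b x = 0 ↔ g x = 0 := by
        rw [← Submodule.coe_eq_zero]; rfl
      rw [this, hfg]
      exact ⟨fun ⟨y, hy⟩ => ⟨y, Subtype.ext hy⟩, fun ⟨y, hy⟩ => ⟨y, congrArg Subtype.val hy⟩⟩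
    rw [← Module.length_ne_top_iff] at hN hL ⊢
    rw [Module.length_eq_add_of_exact a b ha hb hab]
    exact WithTop.add_ne_top.2 ⟨hN, hL⟩
  rw [← Submodule.map_comap_eq_of_surjective hg L]
  exact Submodule.map_mono (hmax _ hc)

end FinitisticLength

/-! ### Dimension of primes, and long chains of ideals above a prime -/

section PrimeDim

variable {R : Type u} [CommRing R]

/-- The dimension of `R ⧸ p`, with junk value `0` when it is infinite. -/
noncomputable def primeDim (p : PrimeSpectrum R) : ℕ := (Order.coheight p).toNat

theorem coheight_lt_top_of_ringKrullDim_lt_top (hdim : ringKrullDim R < ⊤) (p : PrimeSpectrum R) :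
    Order.coheight p < ⊤ := by
  have := (Order.coheight_le_krullDim p).trans_lt hdim
  exact WithBot.coe_lt_coe.1 this

theorem coe_primeDim (hdim : ringKrullDim R < ⊤) (p : PrimeSpectrum R) :
    (primeDim p : ℕ∞) = Order.coheight p :=
  ENat.natCast_toNat (coheight_lt_top_of_ringKrullDim_lt_top hdim p).ne

theorem primeDim_lt_primeDim (hdim : ringKrullDim R < ⊤) {p q : PrimeSpectrum R} (h : p < q) :
    primeDim q < primeDim p := by
  have := Order.coheight_strictAnti h (coheight_lt_top_of_ringKrullDim_lt_top hdim q)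
  rw [← coe_primeDim hdim, ← coe_primeDim hdim] at this
  exact_mod_cast this

theorem exists_forall_primeDim_lt (hdim : ringKrullDim R < ⊤) :
    ∃ D : ℕ, ∀ p : PrimeSpectrum R, primeDim p < D := by
  rcases isEmpty_or_nonempty (PrimeSpectrum R) with h | h
  · exact ⟨0, fun p => h.elim p⟩
  · have hd : ringKrullDim R = (Order.krullDim (PrimeSpectrum R)) := rfl
    obtain ⟨d, hd'⟩ := WithBot.ne_bot_iff_exists.1
      (hd ▸ Order.krullDim_ne_bot_iff.2 h : ringKrullDim R ≠ ⊥)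
    rw [← hd'] at hdim
    obtain ⟨n, rfl⟩ := ENat.ne_top_iff_exists.1 (show d ≠ ⊤ by rintro rfl; exact hdim.ne rfl)
    refine ⟨n + 1, fun p => Nat.lt_succ_of_le ?_⟩
    have h1 := Order.coheight_le_krullDim p
    rw [← hd, ← hd', ← coe_primeDim (by rw [← hd']; exact hdim)] at h1
    exact_mod_cast h1

/-- Choose `q` above `p` of coheight one less, and `x` in `q` but not in `p`. Multiplication by `x ^
n` is injective modulo `p`, so it carries the chain above `q` strictly into the interval from `p +
(x ^ (n + 1))` to `p + (x ^ n)`. Stacking these ω intervals multiplies the order type by ω. -/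
theorem hasChain_of_coheight_eq {d : ℕ} (p : PrimeSpectrum R) (hp : Order.coheight p = d) :
    HasChain p.asIdeal (⊤ : Ideal R) (Ordinal.omega0.{w} ^ d) := by
  induction d generalizing p with
  | zero =>
    rw [pow_zero]
    exact HasChain.one p.2.ne_top.lt_top
  | succ d ih =>
    obtain ⟨-, ⟨q, hpq, hq⟩, -⟩ := Order.coheight_eq_coe_add_one_iff.1 (by exact_mod_cast hp)
    obtain ⟨x, hxq, hxp⟩ := SetLike.exists_of_lt (show p.asIdeal < q.asIdeal from hpq)
    have hxn : ∀ n y, x ^ n * y ∈ p.asIdeal → y ∈ p.asIdeal := fun n y h =>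
      (p.2.mem_or_mem h).resolve_left fun h' => hxp (p.2.mem_of_pow_mem _ h')
    let φ : ℕ → Ideal R → Ideal R := fun n I => p.asIdeal ⊔ Ideal.span {x ^ n} * I
    have hφ : ∀ n I J, q.asIdeal ≤ I → I < J → φ n I < φ n J := by
      intro n I J hI hIJ
      refine lt_of_le_of_ne (sup_le_sup_left (Ideal.mul_mono_right hIJ.le) _) fun heq => ?_
      obtain ⟨j, hjJ, hjI⟩ := SetLike.exists_of_lt hIJ
      have hj : x ^ n * j ∈ φ n I := heq ▸ Submodule.mem_sup_right
        (Ideal.mul_mem_mul (Ideal.mem_span_singleton_self _) hjJ)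
      obtain ⟨a, ha, b, hb, hab⟩ := Submodule.mem_sup.1 hj
      obtain ⟨i, hi, rfl⟩ := Ideal.mem_span_singleton_mul.1 hb
      have : j - i ∈ p.asIdeal := hxn n _ (by
        rwa [mul_sub, ← hab, add_sub_cancel_right])
      exact hjI (by simpa using I.add_mem (hI (hpq.le this)) hi)
    have h0 : φ 0 ⊤ = ⊤ := by simp [φ]
    rw [pow_succ, ← h0]
    refine HasChain.mul_omega0 (fun n => φ n ⊤) (fun n => ?_) (fun n => le_sup_left) fun n => ?_
    · simp only [φ, Ideal.mul_top]
      exact sup_le_sup_left (Ideal.span_singleton_le_span_singleton.2 (pow_dvd_pow _ n.le_succ)) _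
    · have hle : φ (n + 1) ⊤ ≤ φ n q.asIdeal := by
        simp only [φ, Ideal.mul_top]
        refine sup_le_sup_left ?_ _
        rw [pow_succ, ← Ideal.span_singleton_mul_span_singleton]
        exact Ideal.mul_mono_right (by simpa [Ideal.span_le] using hxq)
      exact (ih q hq).map (φ n) (fun I J hI hIJ _ => hφ n I J hI.le hIJ)
        (fun I hI _ => hle.trans_lt (hφ n _ I le_rfl hI))
        (fun I _ _ => sup_le_sup_left (Ideal.mul_mono_right le_top) _)

end PrimeDim

/-! ### Lower bound from associated primes -/

section LowerBound

variable {R : Type u} {M : Type v} [CommRing R] [AddCommGroup M] [Module R M]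

theorem hasChain_range_of_injective (hdim : ringKrullDim R < ⊤) (p : PrimeSpectrum R)
    (f : R ⧸ p.asIdeal →ₗ[R] M) (hf : Function.Injective f) :
    HasChain ⊥ (LinearMap.range f) (Ordinal.omega0.{w} ^ primeDim p) := by
  have hker : LinearMap.ker (f ∘ₗ p.asIdeal.mkQ) = p.asIdeal := by
    rw [LinearMap.ker_comp_of_ker_eq_bot _ (LinearMap.ker_eq_bot.2 hf), Submodule.ker_mkQ]
  have hlt : ∀ I J : Ideal R, p.asIdeal ≤ I → I < J →
      Submodule.map (f ∘ₗ p.asIdeal.mkQ) I < Submodule.map (f ∘ₗ p.asIdeal.mkQ) J := by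
    intro I J hI hIJ
    refine lt_of_le_of_ne (Submodule.map_mono hIJ.le) fun h => hIJ.ne ?_
    rw [← hker] at hI
    simpa [Submodule.comap_map_eq, sup_eq_left.2 hI, sup_eq_left.2 (hI.trans hIJ.le)] using
      congrArg (Submodule.comap (f ∘ₗ p.asIdeal.mkQ)) h
  refine (hasChain_of_coheight_eq p (coe_primeDim hdim p).symm).map
    (Submodule.map (f ∘ₗ p.asIdeal.mkQ)) (fun I J hI hIJ _ => hlt I J hI.le hIJ)
    (fun I hI _ => bot_le.trans_lt (hlt _ I le_rfl hI)) (fun I _ _ => ?_)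
  rw [Submodule.map_comp]
  exact LinearMap.map_le_range

theorem associatedPrimes_sup_subset {K L : Submodule R M} (h : Disjoint K L) :
    associatedPrimes R (K ⊔ L : Submodule R M) ⊆ associatedPrimes R K ∪ associatedPrimes R L := by
  have hinj : Function.Injective (K.subtype.coprod L.subtype) := by
    rw [← LinearMap.ker_eq_bot, LinearMap.ker_coprod_of_disjoint_range]
    · simp
    · simpa using h
  rw [Submodule.sup_eq_range, ← associatedPrimes.prod,
    LinearEquiv.AssociatedPrimes.eq (LinearEquiv.ofInjective _ hinj)]

theorem disjoint_of_disjoint_associatedPrimes [IsNoetherianRing R] {K L : Submodule R M}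
    (h : Disjoint (associatedPrimes R K) (associatedPrimes R L)) : Disjoint K L := by
  rw [disjoint_iff]
  by_contra hne
  have : Nontrivial (K ⊓ L : Submodule R M) := Submodule.nontrivial_iff_ne_bot.2 hne
  obtain ⟨p, hp⟩ := associatedPrimes.nonempty R (K ⊓ L : Submodule R M)
  exact Set.disjoint_left.1 h
    (associatedPrimes.subset_of_injective (Submodule.inclusion_injective inf_le_left) hp)
    (associatedPrimes.subset_of_injective (Submodule.inclusion_injective inf_le_right) hp)

theorem associatedPrimes_quotient_of_isPrime [IsNoetherianRing R] (I : Ideal R) [hI : I.IsPrime] :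
    associatedPrimes R (R ⧸ I) = {I} := by
  rw [associatedPrimes.eq_singleton_of_isPrimary hI.isPrimary, hI.radical]

variable [IsNoetherianRing R] [Module.Finite R M]

theorem mem_assFinset {p : PrimeSpectrum R} :
    p ∈ assFinset R M ↔ p.asIdeal ∈ associatedPrimes R M := by
  simp [assFinset]

/-- One copy of each `R ⧸ p` is adjoined, in increasing order of dimension, so larger powers of ω
land on top of the chain. Controlling the associated primes of `K` keeps every sum direct. -/
theorem exists_submodule_hasChain_omegaSum (hdim : ringKrullDim R < ⊤) (i : ℕ) :
    ∃ K : Submodule R M, (∀ p : PrimeSpectrum R, p.asIdeal ∈ associatedPrimes R K → primeDim p < i) ∧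
      HasChain ⊥ K (omegaSum.{w} (fun j => {p ∈ assFinset R M | primeDim p = j}.card) i) := by
  induction i with
  | zero =>
    refine ⟨⊥, fun p hp => ?_, HasChain.zero _ _⟩
    rw [associatedPrimes.eq_empty_of_subsingleton] at hp
    exact hp.elim
  | succ i ih =>
    obtain ⟨K₀, hK₀, hc₀⟩ := ih
    set n : ℕ → ℕ := fun j => {p ∈ assFinset R M | primeDim p = j}.card
    have key : ∀ T : Finset (PrimeSpectrum R), (∀ p ∈ T, p ∈ assFinset R M ∧ primeDim p = i) →
        ∃ K : Submodule R M,
          (∀ p : PrimeSpectrum R, p.asIdeal ∈ associatedPrimes R K → p ∈ T ∨ primeDim p < i) ∧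
          HasChain ⊥ K (Ordinal.omega0.{w} ^ i * (T.card : Ordinal) + omegaSum n i) := by
      classical
      intro T
      induction T using Finset.induction_on with
      | empty => exact fun _ => ⟨K₀, fun p hp => Or.inr (hK₀ p hp), by simpa using hc₀⟩
      | insert p T hpT ihT =>
        intro hT
        obtain ⟨K, hK, hc⟩ := ihT fun q hq => hT q (Finset.mem_insert_of_mem hq)
        obtain ⟨hpM, hpi⟩ := hT p (Finset.mem_insert_self _ _)
        obtain ⟨-, f, hf⟩ := (isAssociatedPrime_iff_exists_injective_linearMap _ _).1
          (mem_assFinset.1 hpM)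
        have hass : associatedPrimes R (LinearMap.range f) = {p.asIdeal} := by
          have := p.2
          rw [← associatedPrimes_quotient_of_isPrime p.asIdeal]
          exact (LinearEquiv.AssociatedPrimes.eq (LinearEquiv.ofInjective f hf)).symm
        have hdisj : Disjoint K (LinearMap.range f) := by
          refine disjoint_of_disjoint_associatedPrimes ?_
          rw [hass, Set.disjoint_singleton_right]
          intro hp
          rcases hK p hp with h | h
          · exact hpT h
          · lia
        refine ⟨K ⊔ LinearMap.range f, fun q hq => ?_, ?_⟩
        · rcases associatedPrimes_sup_subset hdisj hq with h | h
          · rcases hK q h with h | h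
            · exact Or.inl (Finset.mem_insert_of_mem h)
            · exact Or.inr h
          · rw [hass] at h
            exact Or.inl (by rw [PrimeSpectrum.ext h]; exact Finset.mem_insert_self _ _)
        · have hstep : HasChain K (K ⊔ LinearMap.range f) (Ordinal.omega0.{w} ^ i) := by
            have hlt : ∀ X Y : Submodule R M, X < Y → Y ≤ LinearMap.range f → K ⊔ X < K ⊔ Y := by
              intro X Y hXY hY
              refine lt_of_le_of_ne (sup_le_sup_left hXY.le _) fun h => hXY.ne ?_
              refine eq_of_le_of_inf_le_of_sup_le (z := K) hXY.le ?_ ?_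
              · rw [inf_comm, (hdisj.mono_right hY).eq_bot]
                exact bot_le (α := Submodule R M)
              · rw [sup_comm Y, ← h, sup_comm]
            refine (hpi ▸ hasChain_range_of_injective hdim p f hf).map (K ⊔ ·)
              (fun X Y _ hXY hY => hlt X Y hXY hY) (fun X hX hX' => ?_)
              (fun X _ hX => sup_le_sup_left hX _)
            simpa using hlt ⊥ X hX hX'
          have := hstep.add hc bot_le le_sup_left
          rwa [← add_assoc, ← mul_one_add, ← Nat.cast_one, ← Nat.cast_add, add_comm 1,
            ← Finset.card_insert_of_notMem hpT] at this
    obtain ⟨K, hK, hc⟩ := key {p ∈ assFinset R M | primeDim p = i} fun p hp => by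
      simpa using hp
    refine ⟨K, fun p hp => ?_, hc⟩
    rcases hK p hp with h | h
    · have := (Finset.mem_filter.1 h).2
      lia
    · lia

theorem omegaSum_card_le_ordinalLength (hdim : ringKrullDim R < ⊤) (i : ℕ) :
    omegaSum (fun j => {p ∈ assFinset R M | primeDim p = j}.card) i ≤ ordinalLength R M := by
  obtain ⟨K, -, hK⟩ := exists_submodule_hasChain_omegaSum (M := M) hdim i
  exact (isChainOrdinal_iff_hasChain.2 (hK.mono le_rfl le_top)).le_ordinalLength

end LowerBound

/-! ### Local multiplicities -/

section Multiplicity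

variable {R : Type u} [CommRing R] {M N P : Type*} [AddCommGroup M] [AddCommGroup N]
  [AddCommGroup P] [Module R M] [Module R N] [Module R P]

/-- The finitistic length of the localization of `M` at `p`. -/
noncomputable def primeMult (p : PrimeSpectrum R) (M : Type*) [AddCommGroup M] [Module R M] : ℕ :=
  finitisticLength (Localization.AtPrime p.asIdeal) (LocalizedModule p.asIdeal.primeCompl M)

theorem length_localizedModule_pos {p : PrimeSpectrum R} (h : p ∈ Module.support R M) :
    0 < Module.length (Localization.AtPrime p.asIdeal)
      (LocalizedModule p.asIdeal.primeCompl M) :=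
  Module.length_pos_iff.2 (Module.mem_support_iff.1 h)

variable [IsNoetherianRing R]

/-- A prime of the local ring containing the annihilator contracts to a prime of the support inside
`p`, hence to `p` itself. So the local ring modulo the annihilator is Artinian. -/
theorem isFiniteLength_localizedModule [Module.Finite R M] (p : PrimeSpectrum R)
    (h : ∀ q ∈ Module.support R M, ¬ q < p) :
    IsFiniteLength (Localization.AtPrime p.asIdeal)
      (LocalizedModule p.asIdeal.primeCompl M) := by
  set A := Localization.AtPrime p.asIdeal
  set X := LocalizedModule p.asIdeal.primeCompl M
  have : IsNoetherianRing A := IsLocalization.isNoetherianRing p.asIdeal.primeCompl A inferInstance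
  let I := Module.annihilator A X
  let _ : Module (A ⧸ I) X := Module.quotientAnnihilator
  have hmax : ∀ Q : Ideal A, Q.IsPrime → I ≤ Q → Q.IsMaximal := by
    intro Q hQ hIQ
    let q : PrimeSpectrum R := ⟨Q.comap (algebraMap R A), hQ.comap _⟩
    have hqp : q ≤ p := by
      have := Ideal.comap_mono (f := algebraMap R A) (IsLocalRing.le_maximalIdeal hQ.ne_top)
      exact this.trans_eq (Localization.AtPrime.under_maximalIdeal (I := p.asIdeal))
    have hqM : q ∈ Module.support R M := by
      rw [Module.mem_support_iff_of_finite]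
      intro r hr
      refine hIQ (Module.mem_annihilator.2 fun x => ?_)
      induction x using LocalizedModule.induction_on with
      | h m s =>
        rw [algebraMap_smul, LocalizedModule.smul'_mk, Module.mem_annihilator.1 hr,
          LocalizedModule.zero_mk]
    have heq : q = p := eq_of_le_of_not_lt hqp (h q hqM)
    have : Q = IsLocalRing.maximalIdeal A := by
      rw [← Localization.AtPrime.map_eq_maximalIdeal,
        ← IsLocalization.map_under p.asIdeal.primeCompl A Q]
      exact congrArg (Ideal.map _) (congrArg PrimeSpectrum.asIdeal heq)
    rw [this]
    infer_instance
  have hdim : Ring.KrullDimLE 0 (A ⧸ I) := by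
    rw [Ring.krullDimLE_zero_iff]
    intro Q hQ
    have := hmax _ (hQ.comap (Ideal.Quotient.mk I)) (by
      conv_lhs => rw [← Ideal.mk_ker (I := I)]
      exact Ideal.ker_le_comap _)
    rw [← Ideal.map_comap_of_surjective _ Ideal.Quotient.mk_surjective Q]
    refine (Ideal.map_eq_top_or_isMaximal_of_surjective _ Ideal.Quotient.mk_surjective
      this).resolve_left ?_
    rw [Ideal.map_comap_of_surjective _ Ideal.Quotient.mk_surjective Q]
    exact hQ.ne_top
  have : IsArtinianRing (A ⧸ I) := isArtinianRing_iff_krullDimLE_zero.2 hdim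
  have : IsScalarTower A (A ⧸ I) X := ⟨fun a b x => by
    obtain ⟨b, rfl⟩ := Ideal.Quotient.mk_surjective b
    exact mul_smul a b x⟩
  have : Module.Finite (A ⧸ I) X := Module.Finite.of_restrictScalars_finite A _ _
  have : IsNoetherian (A ⧸ I) X := inferInstance
  have : IsArtinian (A ⧸ I) X := inferInstance
  rw [← Module.length_ne_top_iff,
    Module.length_eq_of_surjective (S := A) (R := A ⧸ I) (M := X) Ideal.Quotient.mk_surjective]
  exact Module.length_ne_top

theorem primeMult_eq_add_of_exact [Module.Finite R M] [Module.Finite R N] {f : N →ₗ[R] M}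
    {g : M →ₗ[R] P} (hf : Function.Injective f) (hg : Function.Surjective g)
    (hfg : Function.Exact f g) (p : PrimeSpectrum R) (h : ∀ q ∈ Module.support R N, ¬ q < p) :
    (primeMult p M : ℕ∞) = Module.length (Localization.AtPrime p.asIdeal)
      (LocalizedModule p.asIdeal.primeCompl N) + primeMult p P := by
  have : IsNoetherianRing (Localization.AtPrime p.asIdeal) :=
    IsLocalization.isNoetherianRing p.asIdeal.primeCompl _ inferInstance
  exact finitisticLength_eq_add_of_exact
    (LocalizedModule.map_injective p.asIdeal.primeCompl f hf)
    (LocalizedModule.map_surjective p.asIdeal.primeCompl g hg)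
    (LocalizedModule.map_exact p.asIdeal.primeCompl f g hfg)
    (isFiniteLength_localizedModule p h)

/-- A nonzero finite-length submodule of the localization has an associated prime with Artinian
quotient domain, so the maximal ideal; this contracts to `p`, which would be associated to `M`. -/
theorem primeMult_eq_zero [Module.Finite R M] {p : PrimeSpectrum R}
    (hp : p.asIdeal ∉ associatedPrimes R M) : primeMult p M = 0 := by
  set A := Localization.AtPrime p.asIdeal
  have : IsNoetherianRing A := IsLocalization.isNoetherianRing p.asIdeal.primeCompl A inferInstance
  obtain ⟨K, hK, hmax⟩ := exists_greatest_isFiniteLength (R := A)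
    (M := LocalizedModule p.asIdeal.primeCompl M)
  have hlen : (primeMult p M : ℕ∞) = _ := finitisticLength_eq hK hmax
  rcases subsingleton_or_nontrivial K with h | h
  · rw [Module.length_eq_zero_iff.2 h] at hlen
    exact_mod_cast hlen
  · obtain ⟨Q, hQ⟩ := associatedPrimes.nonempty A K
    obtain ⟨hQ', f, hf⟩ := (isAssociatedPrime_iff_exists_injective_linearMap _ _).1 hQ
    have hfl : IsFiniteLength A (A ⧸ Q) := hK.of_injective hf
    rw [← Module.length_ne_top_iff, Module.length_eq_of_surjective (S := A) (R := A ⧸ Q)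
      (M := A ⧸ Q) Ideal.Quotient.mk_surjective, Module.length_ne_top_iff,
      ← isArtinianRing_iff_isFiniteLength] at hfl
    have hQmax : Q.IsMaximal :=
      Ideal.Quotient.maximal_of_isField Q (IsArtinianRing.isField_of_isDomain _)
    have hQX := associatedPrimes.subset_of_injective K.subtype_injective hQ
    rw [IsLocalRing.eq_maximalIdeal hQmax,
      ← Module.associatedPrimes.preimage_comap_associatedPrimes_eq_associatedPrimes_of_isLocalizedModule
      (M := M) p.asIdeal.primeCompl _ (LocalizedModule.mkLinearMap p.asIdeal.primeCompl M),
      Set.mem_preimage] at hQX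
    have hcomap : (IsLocalRing.maximalIdeal A).comap (algebraMap R A) = p.asIdeal :=
      Localization.AtPrime.under_maximalIdeal
    exact absurd (hcomap ▸ hQX) hp

theorem primeMult_pos [Module.Finite R M] {p : PrimeSpectrum R}
    (hp : p.asIdeal ∈ associatedPrimes R M) : 0 < primeMult p M := by
  obtain ⟨-, f, hf⟩ := (isAssociatedPrime_iff_exists_injective_linearMap _ _).1 hp
  have hsupp : ∀ q, q ∈ Module.support R (R ⧸ p.asIdeal) ↔ p ≤ q := fun q => by
    simp [Module.support_eq_zeroLocus, PrimeSpectrum.mem_zeroLocus, Ideal.annihilator_quotient]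
  have h1 := primeMult_eq_add_of_exact hf (LinearMap.range f).mkQ_surjective
    (LinearMap.exact_map_mkQ_range f) p fun q hq => ((hsupp q).1 hq).not_gt
  have h2 := length_localizedModule_pos ((hsupp p).2 le_rfl)
  have h3 : (0 : ℕ∞) < primeMult p M := by
    rw [h1]
    exact h2.trans_le le_self_add
  exact_mod_cast h3

end Multiplicity

/-! ### Upper bound from multiplicities -/

section UpperBound

variable {R : Type u} [CommRing R] [IsNoetherianRing R]

/-- The sum of the local multiplicities of `M` at its associated primes of dimension `i`. -/
noncomputable def dimMult (R : Type u) [CommRing R] [IsNoetherianRing R] (M : Type v)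
    [AddCommGroup M] [Module R M] [Module.Finite R M] (i : ℕ) : ℕ :=
  ∑ p ∈ assFinset R M with primeDim p = i, primeMult p M

variable {M : Type v} [AddCommGroup M] [Module R M] [Module.Finite R M] {P : Type*}
  [AddCommGroup P] [Module R P] [Module.Finite R P]

theorem dimMult_eq_sum {T : Finset (PrimeSpectrum R)} (hT : assFinset R M ⊆ T) (i : ℕ) :
    dimMult R M i = ∑ p ∈ T with primeDim p = i, primeMult p M := by
  refine Finset.sum_subset (Finset.filter_subset_filter _ hT) fun p hp hp' => ?_
  refine primeMult_eq_zero fun h => hp' ?_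
  rw [Finset.mem_filter] at hp ⊢
  exact ⟨mem_assFinset.2 h, hp.2⟩

/-- Take `p` of maximal dimension in the support of the kernel. At primes of at least that dimension
the localized kernel has finite length, so multiplicities add; it is nonzero at `p` and vanishes in
larger dimensions. -/
theorem exists_dimMult_lt_of_surjective (hdim : ringKrullDim R < ⊤) {g : M →ₗ[R] P}
    (hg : Function.Surjective g) (hker : LinearMap.ker g ≠ ⊥) :
    ∃ p : PrimeSpectrum R, dimMult R P (primeDim p) < dimMult R M (primeDim p) ∧
      ∀ j, primeDim p < j → dimMult R P j = dimMult R M j := by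
  classical
  set H := LinearMap.ker g
  have : Nontrivial H := Submodule.nontrivial_iff_ne_bot.2 hker
  obtain ⟨D, hD⟩ := exists_forall_primeDim_lt hdim
  obtain ⟨p, hpH, hpmax⟩ : ∃ p ∈ Module.support R H, ∀ q ∈ Module.support R H,
      primeDim q ≤ primeDim p := by
    have hne := (Module.nonempty_support_of_nontrivial (R := R) (M := H)).image primeDim
    have hbdd : BddAbove (primeDim '' Module.support R H) :=
      ⟨D, by rintro _ ⟨q, -, rfl⟩; exact (hD q).le⟩
    obtain ⟨p, hp, hpe⟩ := Nat.sSup_mem hne hbdd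
    exact ⟨p, hp, fun q hq => hpe ▸ le_csSup hbdd ⟨q, hq, rfl⟩⟩
  have hadd : ∀ q : PrimeSpectrum R, primeDim p ≤ primeDim q →
      (primeMult q M : ℕ∞) = Module.length (Localization.AtPrime q.asIdeal)
        (LocalizedModule q.asIdeal.primeCompl H) + primeMult q P := fun q hq =>
    primeMult_eq_add_of_exact H.subtype_injective hg
      (LinearMap.exact_subtype_ker_map g) q fun q' hq' hlt =>
        absurd (hpmax q' hq') (by have := primeDim_lt_primeDim hdim hlt; lia)
  have hle : ∀ q : PrimeSpectrum R, primeDim p ≤ primeDim q →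
      primeMult q P ≤ primeMult q M := fun q hq => by
    have := hadd q hq
    have h2 : (primeMult q P : ℕ∞) ≤ primeMult q M := this ▸ le_add_self
    exact_mod_cast h2
  -- A quotient may acquire new associated primes, so both sums are taken over a common index set.
  let T := assFinset R M ∪ assFinset R P ∪ {p}
  have hT₁ : assFinset R M ⊆ T := Finset.subset_union_left.trans Finset.subset_union_left
  have hT₂ : assFinset R P ⊆ T := Finset.subset_union_right.trans Finset.subset_union_left
  refine ⟨p, ?_, fun j hj => ?_⟩
  · rw [dimMult_eq_sum hT₁, dimMult_eq_sum hT₂]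
    refine Finset.sum_lt_sum (fun q hq => hle q (Finset.mem_filter.1 hq).2.ge)
      ⟨p, by simp [T], ?_⟩
    have hlen := Order.one_le_iff_pos.2 (length_localizedModule_pos hpH)
    rw [← Nat.succ_le_iff, ← Nat.cast_le (α := ℕ∞), hadd p le_rfl, Nat.succ_eq_one_add]
    push_cast
    gcongr
  · rw [dimMult_eq_sum hT₁, dimMult_eq_sum hT₂]
    refine Finset.sum_congr rfl fun q hq => ?_
    have hqj := (Finset.mem_filter.1 hq).2
    have h1 := hadd q (by lia)
    have : q ∉ Module.support R H := fun h => absurd (hpmax q h) (by lia)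
    have := Module.notMem_support_iff.1 this
    rw [Module.length_eq_zero, zero_add] at h1
    exact_mod_cast h1.symm

theorem omegaSum_dimMult_lt_of_surjective (hdim : ringKrullDim R < ⊤) {D : ℕ}
    (hD : ∀ p : PrimeSpectrum R, primeDim p < D) {g : M →ₗ[R] P}
    (hg : Function.Surjective g) (hker : LinearMap.ker g ≠ ⊥) :
    omegaSum.{w} (dimMult R P) D < omegaSum (dimMult R M) D := by
  obtain ⟨p, hlt, heq⟩ := exists_dimMult_lt_of_surjective hdim hg hker
  exact omegaSum_lt_omegaSum (hD p) hlt heq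

/-- Along a chain, the weighted sums of the quotients `M ⧸ f β` increase strictly with `β`, hence
are at least `β`, while all stay strictly below the sum for `M`. A longer chain would be
contradictory at the index equal to that sum. -/
theorem ordinalLength_le_omegaSum_dimMult (hdim : ringKrullDim R < ⊤) {D : ℕ}
    (hD : ∀ p : PrimeSpectrum R, primeDim p < D) :
    ordinalLength R M ≤ omegaSum (dimMult R M) D := by
  refine ordinalLength_le ?_
  rintro α ⟨f, hf, hf'⟩
  have hlt : ∀ x < α, ∀ y < α, x < y → omegaSum.{v} (dimMult R (M ⧸ f x)) D <
      omegaSum (dimMult R (M ⧸ f y)) D := by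
    intro x hx y hy hxy
    have hlt := hf hx hy hxy
    refine omegaSum_dimMult_lt_of_surjective hdim hD (g := Submodule.factor hlt.le)
      (Submodule.factor_surjective hlt.le) fun hbot => ?_
    obtain ⟨z, hz, hz'⟩ := SetLike.exists_of_lt hlt
    have : (f y).mkQ z ∈ LinearMap.ker (Submodule.factor hlt.le) := by
      simpa using hz
    rw [hbot] at this
    exact hz' (by simpa using this)
  have key : ∀ β < α, β ≤ omegaSum.{v} (dimMult R (M ⧸ f β)) D := by
    intro β hβ
    by_contra! hcon
    induction β using WellFoundedLT.induction with
    | ind β ih =>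
      exact ih _ hcon (hcon.trans hβ) (hlt _ (hcon.trans hβ) _ hβ hcon)
  by_contra! hcon
  refine absurd ((key _ hcon).trans_lt (omegaSum_dimMult_lt_of_surjective hdim hD
    (f _).mkQ_surjective ?_)) (lt_irrefl _)
  rw [Submodule.ker_mkQ]
  exact hf' _ hcon

end UpperBound

/-! ### Binary modules and essential submodules -/

section Binary

variable {R : Type u} {M : Type v} [CommRing R] [IsNoetherianRing R] [AddCommGroup M]
  [Module R M] [Module.Finite R M]

/-- Coefficients of a sum of distinct primes are 0 or 1, and `primeMult_pos` excludes 0. -/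
theorem IsBinary.primeMult_eq_one (hM : IsBinary R M) {p : PrimeSpectrum R}
    (hp : p ∈ assFinset R M) : primeMult p M = 1 := by
  classical
  obtain ⟨S, hS⟩ := hM
  have h1 := DFunLike.congr_fun hS p
  simp only [fundamentalCycle, Finsupp.finsetSum_apply, Finsupp.single_apply,
    Finset.sum_ite_eq', hp, if_true] at h1
  have h2 := primeMult_pos (mem_assFinset.1 hp)
  change (primeMult p M : ℤ) = _ at h1
  split_ifs at h1 <;> lia

theorem IsBinary.dimMult_eq_card (hM : IsBinary R M) (i : ℕ) :
    dimMult R M i = {p ∈ assFinset R M | primeDim p = i}.card := by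
  rw [dimMult, Finset.card_eq_sum_ones]
  exact Finset.sum_congr rfl fun p hp => hM.primeMult_eq_one (Finset.mem_filter.1 hp).1

/-- A copy of `R ⧸ p` in `M` has `p` as its only associated prime, so it would meet `N` trivially if
`p` were not associated to `N`. -/
theorem IsEssentialSubmodule.assFinset_eq {N : Submodule R M} (hN : IsEssentialSubmodule N) :
    assFinset R N = assFinset R M := by
  ext p
  rw [mem_assFinset, mem_assFinset]
  refine ⟨fun h => associatedPrimes.subset_of_injective N.subtype_injective h, fun h => ?_⟩
  obtain ⟨-, f, hf⟩ := (isAssociatedPrime_iff_exists_injective_linearMap _ _).1 h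
  have := p.2
  have hass : associatedPrimes R (LinearMap.range f) = {p.asIdeal} := by
    rw [← associatedPrimes_quotient_of_isPrime p.asIdeal]
    exact (LinearEquiv.AssociatedPrimes.eq (LinearEquiv.ofInjective f hf)).symm
  by_contra hp
  refine hN (LinearMap.range f) (fun hbot => ?_) (disjoint_iff.1
    (disjoint_of_disjoint_associatedPrimes (by rwa [hass, Set.disjoint_singleton_right])))
  rw [hbot, associatedPrimes.eq_empty_of_subsingleton] at hass
  exact Set.singleton_ne_empty _ hass.symm

end Binary

theorem propositionP {R : Type*} {M : Type*} [CommRing R] [IsNoetherianRing R]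
    (hdim : ringKrullDim R < ⊤) [AddCommGroup M] [Module R M] [Module.Finite R M]
    (hM : IsBinary R M) (N : Submodule R M) :
    IsOpenSubmodule N ↔ IsEssentialSubmodule N := by
  obtain ⟨D, hD⟩ := exists_forall_primeDim_lt hdim
  have heq : omegaSum (dimMult R M) D =
      omegaSum (fun j => {p ∈ assFinset R M | primeDim p = j}.card) D :=
    omegaSum_congr fun j _ => hM.dimMult_eq_card j
  constructor
  · intro hN H hH hNH
    have hinj : Function.Injective (H.mkQ ∘ₗ N.subtype) := by
      rw [← LinearMap.ker_eq_bot, LinearMap.ker_comp, Submodule.ker_mkQ,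
        ← Submodule.disjoint_iff_comap_eq_bot, disjoint_iff]
      exact hNH
    refine absurd hN (ne_of_lt ?_)
    calc ordinalLength R N ≤ ordinalLength R (M ⧸ H) := ordinalLength_le_of_injective _ hinj
      _ ≤ omegaSum (dimMult R (M ⧸ H)) D := ordinalLength_le_omegaSum_dimMult hdim hD
      _ < omegaSum (dimMult R M) D := omegaSum_dimMult_lt_of_surjective hdim hD
          H.mkQ_surjective (by rwa [Submodule.ker_mkQ])
      _ ≤ ordinalLength R M := heq ▸ omegaSum_card_le_ordinalLength hdim D
  · intro hN
    refine (ordinalLength_le_of_injective N.subtype N.subtype_injective).antisymm ?_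
    calc ordinalLength R M ≤ omegaSum (dimMult R M) D := ordinalLength_le_omegaSum_dimMult hdim hD
      _ = omegaSum (fun j => {p ∈ assFinset R N | primeDim p = j}.card) D := by
          rw [heq, hN.assFinset_eq]
      _ ≤ ordinalLength R N := omegaSum_card_le_ordinalLength hdim D
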